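/- Let $S$ be a compact connected surface (topological $2$-manifold) without boundary with a finite cellular subdivision: a finite simple graph is embedded in $S$, its vertices being distinct points of $S$ and its edges self-avoiding curves joining their end vertices and meeting each other only at vertices; cutting $S$ along the edges gives finitely many two dimensional cells, each of which is a disc whose boundary circle is glued along a closed walk of the graph that uses no edge twice; and every edge lies on the boundary of exactly two different cells. Let $V$ be the set of vertices and $E$ the set of oriented edges: each edge $\{x,y\}$ gives $(x,y)$ and $(y,x)$. Let $F$ be the set of oriented cells: each cell gives two elements $f,f^c$ of $F$, one for each of the two directions of its boundary walk. Write $(x,y)\in f$ if the boundary walk of $f$ runs the edge from $x$ to $y$. Assume that $S$ is orientable, i.e. that one can choose a set $F'\subseteq F$ containing exactly one of the two orientations of each cell such that no $(x,y)\in E$ belongs to two different elements of $F'$. Let $\Lambda^2$ be the space of functions $\psi:F\to\mathbb R$ with $\psi(f^c)=-\psi(f)$, and put $d\psi(x,y)=\sum_{f\in F:\,(x,y)\in f}\psi(f)$ for $(x,y)\in E$. Let $r:V\times V\to[0,\infty)$ be a weight that vanishes outside $E$, let $\phi^r(x,y)=r(x,y)-r(y,x)$ and suppose that $\phi^r\in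 d\Lambda^2$, i.e. $\phi^r=d\psi$ on $E$ for some $\psi\in\Lambda^2$. Let $s(x,y)=r(x,y)-\max\{\phi^r(x,y),0\}$ be the symmetric part of $r$. The elementary cycles are the cycles $(x,y,x)$ with $(x,y)\in E$ and the boundary walks of the elements of $F$, two of them being identified when they contain the same oriented edges; let $\mathcal C^e$ be the finite set of the classes so obtained and, for $C\in\mathcal C^e$, let $r^{C}(x,y)=1$ if $(x,y)\in C$ and $r^{C}(x,y)=0$ otherwise. Let $R^e$ be the set of the weights of the form $\sum_{C\in\mathcal C^e}\rho(C)\,r^{C}$ with $\rho(C)\ge 0$ for all $C$. Take any $F'$ as above, any $E'\subseteq E$ containing exactly one of the two orientations of each edge, and any $\psi\in\Lambda^2$ with $d\psi=\phi^r$. For $(x,y)\in E'$ let $f_+$ be the unique element of $F'$ with $(x,y)\in f_+$, let $f_-$ be the unique element of $F'$ with $(y,x)\in f_-$, and let $$I(x,y)=\left[\min\{\psi(f_-),\psi(f_+)\},\ \max\{\psi(f_-),\psi(f_+)\}\right].$$ Let $\mathcal P(\{I(x,y)\}_{(x,y)\in E'})\subseteq\mathbb R^{E'}$ be the polyhedron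 of all $(s(x,y))_{(x,y)\in E'}$ such that $$s(x,y)+s(x',y')\ \ge\ d\big(I(x,y),I(x',y')\big)\qquad\text{for all }(x,y),(x',y')\in E',$$ where $d(A,B)=\inf\{|a-b|: a\in A,\ b\in B\}$. Then $$r\in R^e\quad\Longleftrightarrow\quad (s(x,y))_{(x,y)\in E'}\in\mathcal P\big(\{I(x,y)\}_{(x,y)\in E'}\big).$$ -/

import Mathlib

/-- A cellular subdivision of a topological surface `S` with (simple) graph `G` on the vertex set `V`
and with set of two dimensional cells `Φ`.  Vertices are points of `S`, edges are self-avoiding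
curves joining their end vertices and meeting each other only at vertices, and cutting `S` along the
edges gives the two dimensional cells: each of them is the injective image of an open disc, and its
characteristic map, defined on the closed disc, runs along a closed walk of `G` on the unit
circle.  Every edge lies on the boundary of exactly two different cells. -/
structure CellularSubdivision (S : Type*) [TopologicalSpace S] {V : Type*} (G : SimpleGraph V)
    (Φ : Type*) where
  /-- the position of a vertex on the surface -/
  point : V → S
  point_injective : Function.Injective point
  /-- the curve on the surface corresponding to an oriented edge -/
  arc : ∀ d : G.Dart, Path (point d.fst) (point d.snd)
  arc_injective : ∀ d, Function.Injective (arc d)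
  /-- the two orientations of an edge are carried by the same curve, run in opposite directions -/
  arc_symm : ∀ (d : G.Dart) (t : unitInterval), arc d.symm t = arc d (unitInterval.symm t)
  /-- a curve meets no vertices but its end points -/
  arc_eq_point : ∀ (d : G.Dart) (t : unitInterval) (v : V),
    arc d t = point v → v = d.fst ∨ v = d.snd
  /-- curves of different edges meet only at vertices -/
  arc_inter : ∀ (d d' : G.Dart) (t t' : unitInterval), d.edge ≠ d'.edge →
    arc d t = arc d' t' → arc d t ∈ Set.range point
  base : Φ → V
  /-- the boundary of a two dimensional cell, run in one of the two possible directions -/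
  bdry : ∀ c : Φ, G.Walk (base c) (base c)
  bdry_isCircuit : ∀ c, (bdry c).IsCircuit
  /-- the characteristic map of a two dimensional cell; only its values on the closed unit disc of
  the plane matter -/
  disc : Φ → ℂ → S
  disc_continuousOn : ∀ c, ContinuousOn (disc c) (Metric.closedBall 0 1)
  disc_injOn : ∀ c, Set.InjOn (disc c) (Metric.ball 0 1)
  /-- the unit circle, cut into as many equal arcs as the boundary walk has steps, is mapped onto
  the successive oriented edges of the walk -/
  disc_circle : ∀ (c : Φ) (k : ℕ) (hk : k < (bdry c).darts.length) (t : unitInterval),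
    disc c (Complex.exp (2 * Real.pi * Complex.I * ((k + (t : ℝ)) / (bdry c).darts.length)))
      = arc ((bdry c).darts[k]) t
  disc_disjoint : ∀ c c' : Φ, c ≠ c' →
    Disjoint (disc c '' Metric.ball 0 1) (disc c' '' Metric.ball 0 1)
  disc_ne_point : ∀ (c : Φ) (z : ℂ), z ∈ Metric.ball (0 : ℂ) 1 → ∀ v, disc c z ≠ point v
  disc_ne_arc : ∀ (c : Φ) (z : ℂ), z ∈ Metric.ball (0 : ℂ) 1 → ∀ d t, disc c z ≠ arc d t
  cover : ∀ p : S, (∃ v, point v = p) ∨ (∃ d t, arc d t = p) ∨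
    ∃ c, ∃ z ∈ Metric.ball (0 : ℂ) 1, disc c z = p
  edge_two_cells : ∀ e ∈ G.edgeSet, {c : Φ | e ∈ (bdry c).edges}.ncard = 2

/-- The set of oriented edges run by a closed walk.  Two cycles are identified when they contain
the same oriented edges, so that this set represents the equivalence class of the cycle. -/
def cycleClass {V : Type*} {G : SimpleGraph V} {x : V} (w : G.Walk x x) : Set (V × V) :=
  {e | ∃ d ∈ w.darts, d.toProd = e}

/-- The elementary cycle `(x, y, x)` associated to an edge. -/
def edgeCycle {V : Type*} {G : SimpleGraph V} (d : G.Dart) : G.Walk d.fst d.fst :=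
  .cons d.adj (.cons d.adj.symm .nil)

open Classical in
/-- The weight of a purely cyclic weighted graph: `1` on the edges of the cycle, `0` elsewhere. -/
noncomputable def cycleWeight {V : Type*} (C : Set (V × V)) (x y : V) : ℝ :=
  if (x, y) ∈ C then 1 else 0

/-- The discrete vector field `φ^r` of a weight, on the oriented edges of `G`. -/
def weightField {V : Type*} (G : SimpleGraph V) (r : V → V → ℝ) (d : G.Dart) : ℝ :=
  r d.fst d.snd - r d.snd d.fst

/-- The symmetric part of a weight `r`, that is `s = r - r^φ` where `φ(x,y) = r(x,y) - r(y,x)` and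
`r^φ` is the positive part of `φ`. -/
def symmetricPart {V : Type*} (r : V → V → ℝ) (x y : V) : ℝ :=
  r x y - max (r x y - r y x) 0

/-- The distance `d(A, B)` between two (nonempty) sets of real numbers. -/
noncomputable def setDist (A B : Set ℝ) : ℝ := sInf (Set.image2 dist A B)

/-- The polyhedron `𝒫({I_i})` of a family of intervals. -/
def intervalPolyhedron {ι : Type*} (I : ι → Set ℝ) : Set (ι → ℝ) :=
  {s | ∀ i j, setDist (I i) (I j) ≤ s i + s j}

namespace CellularSubdivision

variable {S : Type*} [TopologicalSpace S] {V : Type*} {G : SimpleGraph V} {Φ : Type*}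
  (K : CellularSubdivision S G Φ)

/-- The boundary cycle of an oriented two dimensional cell.  An oriented cell is a pair of a cell
and one of two directions of its boundary: `true` for the direction of `bdry`, `false` for the
opposite one. -/
def cellCycle : ∀ f : Φ × Bool, G.Walk (K.base f.1) (K.base f.1)
  | (c, true) => K.bdry c
  | (c, false) => (K.bdry c).reverse

/-- The cell `f^c`: the same cell with the opposite orientation. -/
def _root_.oppositeCell {Φ : Type*} (f : Φ × Bool) : Φ × Bool := (f.1, !f.2)

/-- The oriented edge `d` belongs to the oriented cell `f`. -/
def DartMem (d : G.Dart) (f : Φ × Bool) : Prop := d ∈ (K.cellCycle f).darts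

/-- The equivalence classes of elementary cycles. -/
def elementaryCycles : Set (Set (V × V)) :=
  {C | (∃ d : G.Dart, C = cycleClass (edgeCycle d)) ∨
    ∃ f : Φ × Bool, C = cycleClass (K.cellCycle f)}

/-- The set `R^e` of the weights admitting a cyclic decomposition by elementary cycles, with a
positive measure `ρ` on the (finite, when `V` is) set of elementary cycles. -/
def elementaryWeights : Set (V → V → ℝ) :=
  {r | ∃ ρ : Set (V × V) → ℝ, (∀ C, 0 ≤ ρ C) ∧
    ∀ x y, r x y = ∑ᶠ C ∈ K.elementaryCycles, ρ C * cycleWeight C x y}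

/-- The space `Λ²` of two chains. -/
def _root_.twoChains (Φ : Type*) : Set (Φ × Bool → ℝ) :=
  {ψ | ∀ f, ψ f = -ψ (oppositeCell f)}

open Classical in
/-- The boundary `dψ` of a two chain. -/
noncomputable def boundary [Fintype Φ] (ψ : Φ × Bool → ℝ) (d : G.Dart) : ℝ :=
  ∑ f : Φ × Bool with K.DartMem d f, ψ f

/-- The set `dΛ²`. -/
def boundaries [Fintype Φ] : Set (G.Dart → ℝ) := K.boundary '' twoChains Φ

/-- A choice `F'` of one orientation `(c, o c)` for each cell, such that adjacent cells are
oriented in agreement: no oriented edge belongs to both. -/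
def IsCoherent (o : Φ → Bool) : Prop :=
  ∀ c c' : Φ, c ≠ c' → ∀ d : G.Dart, ¬ (K.DartMem d (c, o c) ∧ K.DartMem d (c', o c'))

/-- Orientability: the two dimensional cells can be coherently oriented. -/
def IsOrientable : Prop := ∃ o : Φ → Bool, K.IsCoherent o

/-- A choice `E'` of exactly one of the two orientations of each edge. -/
def _root_.IsEdgeOrientation {V : Type*} {G : SimpleGraph V} (E' : Set G.Dart) : Prop :=
  ∀ d : G.Dart, d.symm ∈ E' ↔ d ∉ E'

theorem dartMem_or (d : G.Dart) (c : Φ) (b : Bool) (h : d.edge ∈ (K.bdry c).edges) :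
    K.DartMem d (c, b) ∨ K.DartMem d.symm (c, b) := by
  have h1 : d ∈ (K.bdry c).darts ∨ d.symm ∈ (K.bdry c).darts := by
    obtain ⟨d', hd', he⟩ := List.mem_map.1 h
    rcases SimpleGraph.dart_edge_eq_iff d' d |>.1 he with rfl | rfl
    · exact Or.inl hd'
    · exact Or.inr hd'
  cases b
  · simpa [DartMem, cellCycle, SimpleGraph.Walk.darts_reverse, List.mem_map,
      SimpleGraph.Dart.symm_involutive.eq_iff, or_comm] using h1
  · exact h1

theorem edge_mem_of_dartMem {d : G.Dart} {f : Φ × Bool} (h : K.DartMem d f) :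
    d.edge ∈ (K.bdry f.1).edges := by
  obtain ⟨c, b⟩ := f
  cases b
  · have h' : d.edge ∈ (K.bdry c).reverse.edges := List.mem_map.2 ⟨d, h, rfl⟩
    simpa using h'
  · exact List.mem_map.2 ⟨d, h, rfl⟩

/-- For a coherent choice of orientations every oriented edge belongs to exactly one of the chosen
oriented cells. -/
theorem existsUnique_cell {o : Φ → Bool} (ho : K.IsCoherent o) (d : G.Dart) :
    ∃! c : Φ, K.DartMem d (c, o c) := by
  obtain ⟨a, b, hab, hs⟩ := Set.ncard_eq_two.1 (K.edge_two_cells d.edge d.edge_mem)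
  have ha : d.edge ∈ (K.bdry a).edges := by
    have : a ∈ {c : Φ | d.edge ∈ (K.bdry c).edges} := by rw [hs]; simp
    exact this
  have hb : d.edge ∈ (K.bdry b).edges := by
    have : b ∈ {c : Φ | d.edge ∈ (K.bdry c).edges} := by rw [hs]; simp
    exact this
  have huniq : ∀ c c', K.DartMem d (c, o c) → K.DartMem d (c', o c') → c = c' := by
    intro c c' h h'
    by_contra hne
    exact ho c c' hne d ⟨h, h'⟩
  rcases K.dartMem_or d a (o a) ha with h | h
  · exact ⟨a, h, fun c hc => huniq c a hc h⟩
  · rcases K.dartMem_or d b (o b) hb with h' | h'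
    · exact ⟨b, h', fun c hc => huniq c b hc h'⟩
    · exact absurd ⟨h, h'⟩ (ho a b hab d.symm)

/-- The cell `f₊` for `d`: the only one of the chosen oriented cells containing the oriented edge
`d`.  The cell `f₋` for `d` is `cellOf` of the opposite edge `d.symm`. -/
noncomputable def cellOf {o : Φ → Bool} (ho : K.IsCoherent o) (d : G.Dart) : Φ × Bool :=
  ((K.existsUnique_cell ho d).choose, o (K.existsUnique_cell ho d).choose)

/-- The closed interval `I(x,y)` with end points `ψ(f₋)` and `ψ(f₊)`. -/
noncomputable def interval {o : Φ → Bool} (ho : K.IsCoherent o) (ψ : Φ × Bool → ℝ)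
    (d : G.Dart) : Set ℝ :=
  Set.Icc (min (ψ (K.cellOf ho d.symm)) (ψ (K.cellOf ho d)))
    (max (ψ (K.cellOf ho d.symm)) (ψ (K.cellOf ho d)))

end CellularSubdivision

/-! Coherence puts each oriented edge in exactly two oriented cells, `f₊` and the opposite of `f₋`.
Membership in `R^e` means `r = β + ∂a` with `β ≥ 0` symmetric on edges and `a ≥ 0` on oriented cells
(`mem_elementaryWeights_iff`). Comparing antisymmetric parts, `ψ(f) - (a(f) - a(fᶜ))`, for `f` in
`F'`, takes equal values on both sides of every edge, so it is a constant `τ` because the dual graph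
is connected (`eq_of_forall_cellOf_eq`).

For a given `τ` the smallest admissible `a` consists of the positive and negative parts of `ψ - τ`
on `F'`. Then `β ≥ 0` says exactly that `τ` lies within `s(x,y)` of `I(x,y)` for every edge. Such a
`τ` exists iff the intervals enlarged by `s` have a common point, and by Helly's theorem on the line
this holds iff they meet pairwise, which is the polyhedron condition
(`mem_intervalPolyhedron_Icc_iff`).

The dual graph is connected because two complementary families of closed cells without a common edge
could meet only at vertices, and finitely many points do not separate a connected surface. -/

/-! ### Finite sets do not separate manifolds of dimension at least two -/

open Filter Topology Set in
theorem isPreconnected_ball_diff_center {E : Type*} [NormedAddCommGroup E] [NormedSpace ℝ E]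
    (h : 1 < Module.rank ℝ E) (c : E) (ρ : ℝ) : IsPreconnected (Metric.ball c ρ \ {c}) := by
  -- Polar coordinates: the punctured ball is a continuous image of an interval times the unit
  -- sphere, which is connected in dimension at least two.
  have himage : (fun p : ℝ × E => c + p.1 • p.2) '' (Ioo 0 ρ ×ˢ Metric.sphere (0 : E) 1)
      = Metric.ball c ρ \ {c} := by
    ext x
    constructor
    · rintro ⟨⟨s, u⟩, ⟨⟨hs0, hs1⟩, hu⟩, rfl⟩
      have hu' : ‖u‖ = 1 := by simpa using hu
      have hne : u ≠ 0 := by rintro rfl; simp at hu'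
      refine ⟨?_, ?_⟩
      · simpa [norm_smul, hu', abs_of_pos hs0] using hs1
      · simpa using ⟨hs0.ne', hne⟩
    · rintro ⟨hx, hxc⟩
      have hxc' : x - c ≠ 0 := sub_ne_zero.2 hxc
      have hpos : 0 < ‖x - c‖ := norm_pos_iff.2 hxc'
      refine ⟨(‖x - c‖, ‖x - c‖⁻¹ • (x - c)), ⟨⟨hpos, mem_ball_iff_norm.1 hx⟩, ?_⟩, ?_⟩
      · simp [norm_smul, hpos.ne']
      · simp [smul_smul, hpos.ne']
  rw [← himage]
  exact (isPreconnected_Ioo.prod (isPreconnected_sphere h 0 1)).image _ (by fun_prop)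

open Filter Topology Set in
/-- A finite set does not separate a connected manifold of dimension at least two. -/
theorem eq_empty_or_eq_empty_of_union_finite_eq_univ {E : Type*} [NormedAddCommGroup E]
    [NormedSpace ℝ E] (hE : 1 < Module.rank ℝ E) {S : Type*} [TopologicalSpace S] [T1Space S]
    [PreconnectedSpace S] [ChartedSpace E S] {A B P : Set S} (hA : IsOpen A) (hB : IsOpen B)
    (hAB : Disjoint A B) (hP : P.Finite) (hU : A ∪ B ∪ P = Set.univ) : A = ∅ ∨ B = ∅ := by
  have hEnt : Nontrivial E := by
    by_contra hn
    rw [not_nontrivial_iff_subsingleton] at hn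
    rw [rank_subsingleton'] at hE
    exact not_lt_of_gt hE zero_lt_one
  -- A punctured ball in a chart, small enough to avoid `P` away from its centre, is connected and
  -- hence lies in `A` or in `B`. Punctured neighbourhoods are nonempty, so both cannot happen.
  have key : ∀ x : S, (𝓝[≠] x).NeBot ∧ (A ∈ 𝓝[≠] x ∨ B ∈ 𝓝[≠] x) := by
    intro x
    set e := chartAt E x
    have hxe : x ∈ e.source := mem_chart_source E x
    have hW : (P \ {x})ᶜ ∈ 𝓝 x :=
      (hP.subset sdiff_subset).isClosed.isOpen_compl.mem_nhds (by simp)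
    have h1 : e.symm ⁻¹' (P \ {x})ᶜ ∩ e.target ∈ 𝓝 (e x) := by
      refine inter_mem ?_ (e.open_target.mem_nhds (e.map_source hxe))
      apply (e.continuousAt_symm (e.map_source hxe)).preimage_mem_nhds
      rwa [e.left_inv hxe]
    obtain ⟨ρ, hρ, hball⟩ := Metric.mem_nhds_iff.1 h1
    set D := Metric.ball (e x) ρ \ {e x}
    have hD : e.symm '' D ∈ 𝓝[≠] x := by
      have h2 : e.source ∩ e ⁻¹' Metric.ball (e x) ρ ∈ 𝓝 x :=
        inter_mem (e.open_source.mem_nhds hxe)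
          ((e.continuousAt hxe).preimage_mem_nhds (Metric.ball_mem_nhds _ hρ))
      refine mem_of_superset (inter_mem_nhdsWithin {x}ᶜ h2) ?_
      rintro y ⟨hyx, hys, hyb⟩
      exact ⟨e y, ⟨hyb, fun h => hyx (e.injOn hys hxe h)⟩, e.left_inv hys⟩
    have hDpre : IsPreconnected (e.symm '' D) :=
      (isPreconnected_ball_diff_center hE _ _).image _
        (e.continuousOn_symm.mono fun y hy => (hball hy.1).2)
    have hsub : e.symm '' D ⊆ A ∪ B := by
      rintro _ ⟨y, hy, rfl⟩
      have hne : e.symm y ≠ x := by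
        intro h
        apply hy.2
        rw [mem_singleton_iff, ← h, e.right_inv (hball hy.1).2]
      rcases (hU ▸ mem_univ (e.symm y) : e.symm y ∈ A ∪ B ∪ P) with h | h
      · exact h
      · exact absurd ⟨h, hne⟩ (hball hy.1).1
    refine ⟨?_, ?_⟩
    · rw [← mem_closure_iff_nhdsWithin_neBot, mem_closure_iff_nhds]
      intro U hUx
      have h3 : e.symm ⁻¹' U ∩ Metric.ball (e x) ρ ∈ 𝓝 (e x) := by
        refine inter_mem ?_ (Metric.ball_mem_nhds _ hρ)
        apply (e.continuousAt_symm (e.map_source hxe)).preimage_mem_nhds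
        rwa [e.left_inv hxe]
      have : (𝓝[≠] (e x)).NeBot := Module.punctured_nhds_neBot ℝ E (e x)
      obtain ⟨y, hyx, hy⟩ := Filter.nonempty_of_mem (inter_mem_nhdsWithin {e x}ᶜ h3)
      refine ⟨e.symm y, hy.1, fun h => hyx ?_⟩
      rw [mem_singleton_iff] at h ⊢
      rw [← h, e.right_inv (hball hy.2).2]
    · rcases hDpre.subset_or_subset hA hB hAB hsub with h | h
      · exact Or.inl (mem_of_superset hD h)
      · exact Or.inr (mem_of_superset hD h)
  -- The sets of points punctured-surrounded by `A` or by `B` are open and disjoint and cover `S`,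
  -- including the points of `P`; connectedness leaves only one of them.
  have hopen : ∀ U : Set S, IsOpen {x | U ∈ 𝓝[≠] x} := by
    intro U
    rw [isOpen_iff_mem_nhds]
    intro x hx
    have h1 : ∀ᶠ y in 𝓝[≠] x, U ∈ 𝓝[≠] y := by
      have h2 : ∀ᶠ y in 𝓝[≠] x, ∀ᶠ z in 𝓝[≠] y, z ∈ U := by
        obtain ⟨W, hWo, hxW, hWU⟩ := mem_nhdsWithin.1 hx
        have : W ∩ {x}ᶜ ∈ 𝓝[≠] x := 
          inter_mem (mem_nhdsWithin_of_mem_nhds (hWo.mem_nhds hxW)) self_mem_nhdsWithin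
        filter_upwards [this] with y hy
        exact mem_nhdsWithin_of_mem_nhds
          (mem_of_superset ((hWo.inter isOpen_compl_singleton).mem_nhds hy) hWU)
      exact h2
    rw [eventually_nhdsWithin_iff] at h1
    filter_upwards [h1] with y hy
    by_cases hyx : y = x
    · exact hyx ▸ hx
    · exact hy hyx
  have hdisj : ∀ x, ¬ (A ∈ 𝓝[≠] x ∧ B ∈ 𝓝[≠] x) := by
    rintro x ⟨h1, h2⟩
    have := (key x).1
    obtain ⟨y, hy⟩ := Filter.nonempty_of_mem (inter_mem h1 h2)
    exact hAB.le_bot hy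
  have hsub : ∀ U : Set S, IsOpen U → U ⊆ {x | U ∈ 𝓝[≠] x} := fun U hUo x hx =>
    mem_nhdsWithin_of_mem_nhds (hUo.mem_nhds hx)
  rcases isPreconnected_univ.subset_or_subset (hopen A) (hopen B)
    (Set.disjoint_left.2 fun x h1 h2 => hdisj x ⟨h1, h2⟩)
    (fun x _ => (key x).2) with h | h
  · right
    refine eq_empty_of_forall_notMem fun x hx => hdisj x ⟨h (mem_univ x), hsub B hB hx⟩
  · left
    refine eq_empty_of_forall_notMem fun x hx => hdisj x ⟨hsub A hA hx, h (mem_univ x)⟩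

/-! ### Coherent orientations and the boundary operator -/

namespace CellularSubdivision

variable {S : Type*} [TopologicalSpace S] {V : Type*} {G : SimpleGraph V} {Φ : Type*}
  (K : CellularSubdivision S G Φ)

theorem dartMem_oppositeCell {d : G.Dart} {f : Φ × Bool} :
    K.DartMem d (oppositeCell f) ↔ K.DartMem d.symm f := by
  obtain ⟨c, b⟩ := f
  cases b
  · change d ∈ (K.bdry c).darts ↔ d.symm ∈ (K.bdry c).reverse.darts
    simp [SimpleGraph.Walk.darts_reverse, SimpleGraph.Dart.symm_involutive.eq_iff]
  · change d ∈ (K.bdry c).reverse.darts ↔ d.symm ∈ (K.bdry c).darts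
    simp [SimpleGraph.Walk.darts_reverse, SimpleGraph.Dart.symm_involutive.eq_iff]

section Coherent

variable {o : Φ → Bool} (ho : K.IsCoherent o)

theorem dartMem_cellOf (d : G.Dart) : K.DartMem d (K.cellOf ho d) :=
  (K.existsUnique_cell ho d).choose_spec.1

theorem cellOf_eq {d : G.Dart} {c : Φ} (h : K.DartMem d (c, o c)) : K.cellOf ho d = (c, o c) := by
  have := (K.existsUnique_cell ho d).choose_spec.2 c h
  rw [cellOf, ← this]

/-- An oriented cell outside `F'` that contains `d` is the opposite of a cell of `F'` containing
`d.symm`, and that cell is unique. -/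
theorem dartMem_iff (d : G.Dart) (f : Φ × Bool) :
    K.DartMem d f ↔ f = K.cellOf ho d ∨ f = oppositeCell (K.cellOf ho d.symm) := by
  constructor
  · obtain ⟨c, b⟩ := f
    intro h
    by_cases hb : b = o c
    · subst hb
      exact Or.inl (K.cellOf_eq ho h).symm
    · right
      have hb' : (c, b) = oppositeCell (c, o c) := by
        simp only [oppositeCell, Prod.mk.injEq, true_and]
        cases b <;> cases h : o c <;> simp_all
      rw [hb', K.dartMem_oppositeCell] at h
      rw [K.cellOf_eq ho h, hb']
  · rintro (rfl | rfl)
    · exact K.dartMem_cellOf ho d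
    · exact K.dartMem_oppositeCell.2 (K.dartMem_cellOf ho d.symm)

theorem cellOf_snd (d : G.Dart) : (K.cellOf ho d).2 = o (K.cellOf ho d).1 := rfl

theorem boundary_eq [Fintype Φ] (a : Φ × Bool → ℝ) (d : G.Dart) :
    K.boundary a d = a (K.cellOf ho d) + a (oppositeCell (K.cellOf ho d.symm)) := by
  classical
  -- If the underlying cells agree, both carry the orientation chosen by `o`, and `oppositeCell`
  -- flips one of them.
  have hne : K.cellOf ho d ≠ oppositeCell (K.cellOf ho d.symm) := by
    intro h
    have h1 : (K.cellOf ho d).1 = (K.cellOf ho d.symm).1 := (Prod.mk.inj h).1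
    have h2 : (K.cellOf ho d).2 = !(K.cellOf ho d.symm).2 := (Prod.mk.inj h).2
    rw [cellOf_snd, cellOf_snd, h1] at h2
    simp at h2
  rw [boundary, ← Finset.sum_pair hne]
  congr 1
  ext f
  simp [K.dartMem_iff ho]

end Coherent

/-! ### Connectedness of the dual graph -/

theorem exists_arc_of_mem_sphere (c : Φ) {z : ℂ} (hz : ‖z‖ = 1) :
    ∃ d ∈ (K.bdry c).darts, ∃ t, K.disc c z = K.arc d t := by
  set n := (K.bdry c).darts.length with hn
  have hn0 : 0 < n := by
    rw [List.length_pos_iff]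
    intro h
    apply (K.bdry_isCircuit c).ne_nil
    rw [SimpleGraph.Walk.eq_nil_iff_nil, ← SimpleGraph.Walk.length_eq_zero_iff,
      ← SimpleGraph.Walk.length_darts, h, List.length_nil]
  have hn0' : (0 : ℝ) < n := by exact_mod_cast hn0
  obtain ⟨θ, hθ⟩ := (Complex.norm_eq_one_iff z).1 hz
  -- The angle as a fraction of a full turn, in `[0, 1)`: the integer part of `u * n` selects the
  -- edge, strictly below `n`, and the remainder is the parameter on it.
  set u := Int.fract (θ / (2 * Real.pi)) with hu
  have hu0 : 0 ≤ u := Int.fract_nonneg _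
  have hu1 : u < 1 := Int.fract_lt_one _
  have hzu : z = Complex.exp (2 * Real.pi * Complex.I * u) := by
    rw [← hθ, Complex.exp_eq_exp_iff_exists_int]
    refine ⟨⌊θ / (2 * Real.pi)⌋, ?_⟩
    have h1 : θ = 2 * Real.pi * (u + ⌊θ / (2 * Real.pi)⌋) := by
      rw [hu, Int.fract_add_floor]
      field_simp
    have h2 : (θ : ℂ) = 2 * Real.pi * (u + ⌊θ / (2 * Real.pi)⌋) := by exact_mod_cast h1
    linear_combination Complex.I * h2
  have hk : ⌊u * n⌋₊ < n := by
    rw [Nat.floor_lt (by positivity)]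
    nlinarith
  have ht0 : 0 ≤ u * n - ⌊u * n⌋₊ := sub_nonneg.2 (Nat.floor_le (by positivity))
  have ht1 : u * n - ⌊u * n⌋₊ ≤ 1 := by linarith [Nat.lt_floor_add_one (u * n)]
  refine ⟨(K.bdry c).darts[⌊u * n⌋₊], List.getElem_mem _, ⟨_, ht0, ht1⟩, ?_⟩
  rw [← K.disc_circle c _ hk, hzu, ← hn]
  congr 3
  have : (n : ℂ) ≠ 0 := by exact_mod_cast hn0.ne'
  push_cast
  field_simp
  ring

theorem arc_mem_image_disc {d : G.Dart} {c : Φ} (h : d.edge ∈ (K.bdry c).edges)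
    (t : unitInterval) : K.arc d t ∈ K.disc c '' Metric.closedBall 0 1 := by
  have key : ∀ d' ∈ (K.bdry c).darts, ∀ t, K.arc d' t ∈ K.disc c '' Metric.closedBall 0 1 := by
    intro d' hd' t
    obtain ⟨k, hk, rfl⟩ := List.mem_iff_getElem.1 hd'
    rw [← K.disc_circle c k hk t]
    refine ⟨_, ?_, rfl⟩
    rw [mem_closedBall_zero_iff]
    have : 2 * Real.pi * Complex.I * ((k + ((t : ℝ) : ℂ)) / (K.bdry c).darts.length)
        = ((2 * Real.pi * ((k + (t : ℝ)) / (K.bdry c).darts.length) : ℝ) : ℂ) * Complex.I := by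
      push_cast
      ring
    rw [this, Complex.norm_exp_ofReal_mul_I]
  obtain ⟨d', hd', he⟩ := List.mem_map.1 h
  rcases SimpleGraph.dart_edge_eq_iff d' d |>.1 he with rfl | rfl
  · exact key _ hd' t
  · have := key _ hd' (unitInterval.symm t)
    rwa [K.arc_symm, unitInterval.symm_symm] at this

/-- The union of the closed cells belonging to `Q`. -/
def closedCells (Q : Set Φ) : Set S := ⋃ c ∈ Q, K.disc c '' Metric.closedBall 0 1

theorem isClosed_closedCells [T2Space S] [Finite Φ] (Q : Set Φ) : IsClosed (K.closedCells Q) :=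
  Q.toFinite.isClosed_biUnion fun c _ =>
    ((isCompact_closedBall _ _).image_of_continuousOn (K.disc_continuousOn c)).isClosed

theorem mem_closedCells_iff {Q : Set Φ} {p : S} (hp : p ∉ Set.range K.point) :
    p ∈ K.closedCells Q ↔ (∃ c ∈ Q, ∃ z ∈ Metric.ball (0 : ℂ) 1, K.disc c z = p) ∨
      ∃ c ∈ Q, ∃ d ∈ (K.bdry c).darts, ∃ t, K.arc d t = p := by
  constructor
  · intro h
    obtain ⟨c, hc, z, hz, rfl⟩ := Set.mem_iUnion₂.1 h
    rcases (mem_closedBall_zero_iff.1 hz).lt_or_eq with h1 | h1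
    · exact Or.inl ⟨c, hc, z, by simpa using h1, rfl⟩
    · obtain ⟨d, hd, t, ht⟩ := K.exists_arc_of_mem_sphere c h1
      exact Or.inr ⟨c, hc, d, hd, t, ht.symm⟩
  · rintro (⟨c, hc, z, hz, rfl⟩ | ⟨c, hc, d, hd, t, rfl⟩)
    · exact Set.mem_iUnion₂.2 ⟨c, hc, z, Metric.ball_subset_closedBall hz, rfl⟩
    · exact Set.mem_iUnion₂.2 ⟨c, hc, K.arc_mem_image_disc (List.mem_map.2 ⟨d, hd, rfl⟩) t⟩

/-- The dual graph of a cellular subdivision of a connected surface is connected: a set of cells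
that contains with a cell all the cells sharing an edge with it is empty or full. -/
theorem eq_empty_or_eq_univ_of_adjacent {E : Type*} [NormedAddCommGroup E] [NormedSpace ℝ E]
    (hE : 1 < Module.rank ℝ E) [T2Space S] [PreconnectedSpace S] [ChartedSpace E S] [Finite V]
    [Finite Φ] {Q : Set Φ}
    (hQ : ∀ c c' : Φ, ∀ e ∈ G.edgeSet, e ∈ (K.bdry c).edges → e ∈ (K.bdry c').edges →
      c ∈ Q → c' ∈ Q) : Q = ∅ ∨ Q = Set.univ := by
  set P := Set.range K.point
  have hcov : ∀ p ∉ P, p ∈ K.closedCells Q ∨ p ∈ K.closedCells Qᶜ := by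
    intro p hp
    have hor : (∃ c, ∃ z ∈ Metric.ball (0 : ℂ) 1, K.disc c z = p) ∨
        ∃ c, ∃ d ∈ (K.bdry c).darts, ∃ t, K.arc d t = p := by
      rcases K.cover p with ⟨v, rfl⟩ | ⟨d, t, rfl⟩ | h
      · exact absurd ⟨v, rfl⟩ hp
      · have h2 := K.edge_two_cells d.edge d.edge_mem
        obtain ⟨c, hc⟩ := Set.nonempty_of_ncard_ne_zero (h2 ▸ two_ne_zero)
        rcases List.mem_map.1 (show d.edge ∈ (K.bdry c).edges from hc) with ⟨d', hd', he⟩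
        rcases SimpleGraph.dart_edge_eq_iff d' d |>.1 he with rfl | rfl
        · exact Or.inr ⟨c, _, hd', t, rfl⟩
        · refine Or.inr ⟨c, _, hd', unitInterval.symm t, ?_⟩
          rw [K.arc_symm, unitInterval.symm_symm]
      · exact Or.inl h
    rw [K.mem_closedCells_iff hp, K.mem_closedCells_iff hp]
    rcases hor with ⟨c, h⟩ | ⟨c, h⟩ <;> by_cases hc : c ∈ Q
    · exact Or.inl (Or.inl ⟨c, hc, h⟩)
    · exact Or.inr (Or.inl ⟨c, hc, h⟩)
    · exact Or.inl (Or.inr ⟨c, hc, h⟩)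
    · exact Or.inr (Or.inr ⟨c, hc, h⟩)
  have hsep : ∀ p ∉ P, p ∈ K.closedCells Q → p ∉ K.closedCells Qᶜ := by
    intro p hp h h'
    rw [K.mem_closedCells_iff hp] at h h'
    rcases h with ⟨c, hc, z, hz, rfl⟩ | ⟨c, hc, d, hd, t, rfl⟩
    · rcases h' with ⟨c', hc', z', hz', h'⟩ | ⟨c', hc', d, hd, t, h'⟩
      · have hne : c ≠ c' := by rintro rfl; exact hc' hc
        exact Set.disjoint_left.1 (K.disc_disjoint c c' hne) ⟨z, hz, rfl⟩ ⟨z', hz', h'⟩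
      · exact K.disc_ne_arc c z hz d t h'.symm
    · rcases h' with ⟨c', hc', z', hz', h'⟩ | ⟨c', hc', d', hd', t', h'⟩
      · exact K.disc_ne_arc c' z' hz' d t h'
      · by_cases he : d.edge = d'.edge
        · exact hc' (hQ c c' d.edge d.edge_mem (List.mem_map.2 ⟨d, hd, rfl⟩)
            (he ▸ List.mem_map.2 ⟨d', hd', rfl⟩) hc)
        · exact hp (K.arc_inter d d' t t' he h'.symm)
  have hPfin : P.Finite := Set.finite_range _
  -- Cell centres are not vertices, so a nonempty family of cells covers some point outside `P`.
  have hcenter : ∀ (R : Set Φ) (c : Φ), c ∈ R → K.disc c 0 ∉ P ∧ K.disc c 0 ∈ K.closedCells R :=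
    fun R c hc => ⟨fun ⟨v, hv⟩ => K.disc_ne_point c 0 (by simp) v hv.symm,
      Set.mem_iUnion₂.2 ⟨c, hc, 0, by simp, rfl⟩⟩
  -- Off the vertices every point lies in exactly one of the two closed unions, so their complements
  -- with `P` removed are disjoint open sets covering everything but `P`.
  have hdisj : Disjoint (P ∪ K.closedCells Q)ᶜ (P ∪ K.closedCells Qᶜ)ᶜ := by
    refine Set.disjoint_left.2 fun p h1 h2 => ?_
    rcases hcov p (fun h => h1 (Or.inl h)) with h | h
    exacts [h1 (Or.inr h), h2 (Or.inr h)]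
  have huniv : (P ∪ K.closedCells Q)ᶜ ∪ (P ∪ K.closedCells Qᶜ)ᶜ ∪ P = Set.univ := by
    refine Set.eq_univ_of_forall fun p => ?_
    by_cases hp : p ∈ P
    · exact Or.inr hp
    · left
      by_cases h : p ∈ K.closedCells Q
      · exact Or.inr (by rintro (h3 | h3); exacts [hp h3, hsep p hp h h3])
      · exact Or.inl (by rintro (h3 | h3); exacts [hp h3, h h3])
  rcases eq_empty_or_eq_empty_of_union_finite_eq_univ hE
    (hPfin.isClosed.union (K.isClosed_closedCells Q)).isOpen_compl
    (hPfin.isClosed.union (K.isClosed_closedCells Qᶜ)).isOpen_compl hdisj hPfin huniv with h | h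
  · right
    refine Set.eq_univ_of_forall fun c => by_contra fun hc => ?_
    obtain ⟨h1, h2⟩ := hcenter Qᶜ c hc
    refine h.subset (show K.disc c 0 ∈ _ from ?_)
    rintro (h3 | h3)
    exacts [h1 h3, hsep _ h1 h3 h2]
  · left
    refine Set.eq_empty_of_forall_notMem fun c hc => ?_
    obtain ⟨h1, h2⟩ := hcenter Q c hc
    refine h.subset (show K.disc c 0 ∈ _ from ?_)
    rintro (h3 | h3)
    exacts [h1 h3, hsep _ h1 h2 h3]

/-- The level set of `t` through `c'` is nonempty and closed under adjacency, so it contains all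
cells. -/
theorem eq_of_forall_cellOf_eq {E : Type*} [NormedAddCommGroup E] [NormedSpace ℝ E]
    (hE : 1 < Module.rank ℝ E) [T2Space S] [PreconnectedSpace S] [ChartedSpace E S] [Finite V]
    [Finite Φ] {o : Φ → Bool} (ho : K.IsCoherent o) {α : Type*} {t : Φ → α}
    (ht : ∀ d : G.Dart, t (K.cellOf ho d).1 = t (K.cellOf ho d.symm).1) (c c' : Φ) :
    t c = t c' := by
  have key : ∀ (d : G.Dart) (c : Φ), d.edge ∈ (K.bdry c).edges → t c = t (K.cellOf ho d).1 := by
    intro d c hc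
    rcases K.dartMem_or d c (o c) hc with h | h
    · rw [K.cellOf_eq ho h]
    · rw [ht d, K.cellOf_eq ho h]
  have hadj : ∀ a b : Φ, ∀ e ∈ G.edgeSet, e ∈ (K.bdry a).edges → e ∈ (K.bdry b).edges →
      a ∈ {x | t x = t c'} → b ∈ {x | t x = t c'} := by
    intro a b e he ha hb hat
    induction e with
    | _ x y =>
      have h1 := key ⟨(x, y), he⟩ a ha
      have h2 := key ⟨(x, y), he⟩ b hb
      exact (h2.trans h1.symm).trans hat
  rcases K.eq_empty_or_eq_univ_of_adjacent hE hadj with h | h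
  · exact absurd (show c' ∈ {x | t x = t c'} from rfl) (h ▸ Set.notMem_empty c')
  · exact (h ▸ Set.mem_univ c : c ∈ {x | t x = t c'})

end CellularSubdivision

/-! ### Cycle classes, interval distances and cycle weights -/

/-- A nonnegative combination indexed by the range of a family can be indexed by the family. -/
theorem exists_sum_eq_finsum_range {J α β : Type*} [Fintype J] (i : J → α) (w : α → β → ℝ)
    (r : β → ℝ) :
    (∃ ρ : α → ℝ, (∀ C, 0 ≤ ρ C) ∧ ∀ x, r x = ∑ᶠ C ∈ Set.range i, ρ C * w C x) ↔
      ∃ a : J → ℝ, (∀ j, 0 ≤ a j) ∧ ∀ x, r x = ∑ j, a j * w (i j) x := by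
  classical
  have hrange : Set.range i = ((Finset.univ.image i : Finset α) : Set α) := by simp
  constructor
  · rintro ⟨ρ, hρ, hr⟩
    -- Several indices may give the same class: one representative per class receives all its
    -- weight. Conversely, the weights on each fibre are added up.
    obtain ⟨T, -, hT, himage⟩ := Finset.exists_subset_injOn_image_eq_of_surjOn (f := i)
      (Set.univ : Set J) (Finset.univ.image i) (by simp [Set.SurjOn])
    refine ⟨fun j => if j ∈ T then ρ (i j) else 0, fun j => ?_, fun x => ?_⟩
    · dsimp only
      split_ifs
      exacts [hρ _, le_rfl]
    · rw [hr, hrange, finsum_mem_coe_finset, ← himage, Finset.sum_image hT]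
      simp [ite_mul, Finset.sum_ite_mem]
  · rintro ⟨a, ha, hr⟩
    refine ⟨fun C => ∑ j with i j = C, a j, fun C => Finset.sum_nonneg fun j _ => ha j,
      fun x => ?_⟩
    rw [hr, hrange, finsum_mem_coe_finset,
      ← Finset.sum_fiberwise_of_maps_to (g := i) (t := Finset.univ.image i) (by simp)]
    refine Finset.sum_congr rfl fun C _ => ?_
    rw [Finset.sum_mul]
    refine Finset.sum_congr rfl fun j hj => ?_
    rw [(Finset.mem_filter.1 hj).2]

theorem setDist_Icc_le {a b a' b' x x' : ℝ} (hx : x ∈ Set.Icc a b) (hx' : x' ∈ Set.Icc a' b') :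
    setDist (Set.Icc a b) (Set.Icc a' b') ≤ |x - x'| := by
  refine csInf_le ⟨0, ?_⟩ ⟨x, hx, x', hx', Real.dist_eq x x'⟩
  rintro _ ⟨y, -, y', -, rfl⟩
  exact dist_nonneg

theorem sub_le_setDist_Icc {a b a' b' : ℝ} (h : a ≤ b) (h' : a' ≤ b') :
    a' - b ≤ setDist (Set.Icc a b) (Set.Icc a' b') := by
  refine le_csInf ⟨_, a, ⟨le_rfl, h⟩, a', ⟨le_rfl, h'⟩, rfl⟩ ?_
  rintro _ ⟨y, hy, y', hy', rfl⟩
  rw [Real.dist_eq]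
  linarith [neg_abs_le (y - y'), hy.2, hy'.1]

theorem exists_mem_Icc_abs_sub_le {a b τ δ : ℝ} (h : a ≤ b) (hδ : 0 ≤ δ) (h1 : a - δ ≤ τ)
    (h2 : τ ≤ b + δ) : ∃ x ∈ Set.Icc a b, |x - τ| ≤ δ := by
  rcases le_total τ a with h3 | h3
  · exact ⟨a, ⟨le_rfl, h⟩, abs_le.2 ⟨by linarith, by linarith⟩⟩
  · rcases le_total τ b with h4 | h4
    · exact ⟨τ, ⟨h3, h4⟩, by simpa using hδ⟩
    · exact ⟨b, ⟨h, le_rfl⟩, abs_le.2 ⟨by linarith, by linarith⟩⟩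

theorem symmetricPart_eq_min {V : Type*} (r : V → V → ℝ) (x y : V) :
    symmetricPart r x y = min (r x y) (r y x) := by
  rw [symmetricPart]
  rcases le_total (r x y) (r y x) with h | h
  · rw [min_eq_left h, max_eq_right (by linarith), sub_zero]
  · rw [min_eq_right h, max_eq_left (by linarith), sub_sub_cancel]

open Classical in
theorem cycleWeight_cycleClass {V : Type*} {G : SimpleGraph V} {x : V} (w : G.Walk x x)
    (d : G.Dart) :
    cycleWeight (cycleClass w) d.fst d.snd = if d ∈ w.darts then 1 else 0 := by
  have : (d.fst, d.snd) ∈ cycleClass w ↔ d ∈ w.darts := by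
    constructor
    · rintro ⟨d', hd', h⟩
      rwa [← SimpleGraph.Dart.ext d' d h]
    · exact fun h => ⟨d, h, rfl⟩
  simp only [cycleWeight, this]

theorem cycleWeight_of_not_adj {V : Type*} {G : SimpleGraph V} {x : V} (w : G.Walk x x)
    {u v : V} (h : ¬ G.Adj u v) : cycleWeight (cycleClass w) u v = 0 := by
  refine if_neg ?_
  rintro ⟨d, -, hd⟩
  apply h
  have := d.adj
  rwa [show d.fst = u from congrArg Prod.fst hd, show d.snd = v from congrArg Prod.snd hd] at this

theorem mem_darts_edgeCycle {V : Type*} {G : SimpleGraph V} {d d' : G.Dart} :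
    d ∈ (edgeCycle d').darts ↔ d' = d ∨ d' = d.symm := by
  have : (edgeCycle d').darts = [d', d'.symm] := rfl
  rw [this, List.mem_pair, eq_comm, SimpleGraph.Dart.symm_involutive.eq_iff.symm]
  tauto

/-! ### Elementary weights as symmetric part plus boundary -/

namespace CellularSubdivision

variable {S : Type*} [TopologicalSpace S] {V : Type*} {G : SimpleGraph V} {Φ : Type*}
  (K : CellularSubdivision S G Φ)

/-- The elementary weights are the sums of a symmetric weight and of the boundary of a positive
function of the oriented cells. -/
theorem mem_elementaryWeights_iff [Finite V] [Fintype Φ] {r : V → V → ℝ} :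
    r ∈ K.elementaryWeights ↔ (∀ x y, ¬ G.Adj x y → r x y = 0) ∧
      ∃ β : G.Dart → ℝ, (∀ d, 0 ≤ β d) ∧ (∀ d, β d.symm = β d) ∧
        ∃ a : Φ × Bool → ℝ, (∀ f, 0 ≤ a f) ∧
          ∀ d : G.Dart, r d.fst d.snd = β d + K.boundary a d := by
  classical
  have : Finite G.Dart := Finite.of_injective _ SimpleGraph.Dart.toProd_injective
  have := Fintype.ofFinite G.Dart
  let i : G.Dart ⊕ Φ × Bool → Set (V × V) :=
    Sum.elim (fun d => cycleClass (edgeCycle d)) (fun f => cycleClass (K.cellCycle f))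
  have hrange : K.elementaryCycles = Set.range i := by
    ext C
    simp [elementaryCycles, i, eq_comm]
  have hmem : r ∈ K.elementaryWeights ↔ ∃ a : G.Dart ⊕ Φ × Bool → ℝ, (∀ j, 0 ≤ a j) ∧
      ∀ p : V × V, r p.1 p.2 = ∑ j, a j * cycleWeight (i j) p.1 p.2 := by
    rw [← exists_sum_eq_finsum_range i (fun C (p : V × V) => cycleWeight C p.1 p.2) (fun p => r p.1 p.2),
      ← hrange]
    simp only [elementaryWeights, Set.mem_ofPred_eq, Prod.forall]
  have hsum : ∀ (a : G.Dart ⊕ Φ × Bool → ℝ) (d : G.Dart),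
      ∑ j, a j * cycleWeight (i j) d.fst d.snd =
        (a (Sum.inl d) + a (Sum.inl d.symm)) + K.boundary (fun f => a (Sum.inr f)) d := by
    intro a d
    rw [Fintype.sum_sum_type]
    congr 1
    -- Both `d` and `d.symm` index an elementary cycle through `d`.
    · rw [← Finset.sum_pair (f := fun d' => a (Sum.inl d')) d.symm_ne.symm]
      simp only [i, Sum.elim_inl, cycleWeight_cycleClass, mul_ite, mul_one, mul_zero]
      rw [← Finset.sum_filter]
      congr 1
      ext d'
      simp [mem_darts_edgeCycle]
    · simp only [i, Sum.elim_inr, cycleWeight_cycleClass, mul_ite, mul_one, mul_zero]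
      rw [← Finset.sum_filter, boundary]
      congr!
  have hzero : ∀ (j : G.Dart ⊕ Φ × Bool) {x y : V}, ¬ G.Adj x y → cycleWeight (i j) x y = 0 := by
    rintro (d | f) x y h
    exacts [cycleWeight_of_not_adj _ h, cycleWeight_of_not_adj _ h]
  rw [hmem]
  constructor
  · rintro ⟨a, ha, hr⟩
    refine ⟨fun x y h => ?_, fun d => a (Sum.inl d) + a (Sum.inl d.symm),
      fun d => add_nonneg (ha _) (ha _), fun d => ?_, fun f => a (Sum.inr f), fun f => ha _,
      fun d => (hr d.toProd).trans (hsum a d)⟩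
    · rw [hr (x, y)]
      exact Finset.sum_eq_zero fun j _ => by rw [hzero j h, mul_zero]
    · simp only [SimpleGraph.Dart.symm_symm, add_comm]
  · rintro ⟨h0, β, hβ, hβs, a, ha, hr⟩
    -- The two orientations of an edge index the same class and both contribute, hence the factor
    -- one half.
    refine ⟨Sum.elim (fun d => β d / 2) a, ?_, ?_⟩
    · rintro (d | f)
      exacts [div_nonneg (hβ d) zero_le_two, ha f]
    · rintro ⟨x, y⟩
      by_cases h : G.Adj x y
      · have h1 := hr ⟨(x, y), h⟩
        have h2 := hsum (Sum.elim (fun d => β d / 2) a) ⟨(x, y), h⟩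
        simp only [Sum.elim_inl, Sum.elim_inr, hβs, add_halves] at h2
        exact h1.trans h2.symm
      · exact (h0 x y h).trans
          (Finset.sum_eq_zero fun j _ => by rw [hzero j h, mul_zero]).symm

end CellularSubdivision

/-! ### Helly's theorem on the line and the main equivalence -/

theorem symmetricPart_nonneg {V : Type*} {r : V → V → ℝ} (hr : ∀ x y, 0 ≤ r x y) (x y : V) :
    0 ≤ symmetricPart r x y := by
  rw [symmetricPart_eq_min]
  exact le_min (hr _ _) (hr _ _)

theorem symmetricPart_comm {V : Type*} (r : V → V → ℝ) (x y : V) :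
    symmetricPart r x y = symmetricPart r y x := by
  rw [symmetricPart_eq_min, symmetricPart_eq_min, min_comm]

/-- Intervals that are enlarged so that they meet pairwise have a common point. -/
theorem mem_intervalPolyhedron_Icc_iff {ι : Type*} [Finite ι] {lo hi s : ι → ℝ}
    (h : ∀ i, lo i ≤ hi i) (hs : ∀ i, 0 ≤ s i) :
    s ∈ intervalPolyhedron (fun i => Set.Icc (lo i) (hi i)) ↔
      ∃ τ, ∀ i, lo i - s i ≤ τ ∧ τ ≤ hi i + s i := by
  constructor
  · intro hP
    rcases isEmpty_or_nonempty ι with _ | _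
    · exact ⟨0, fun i => isEmptyElim i⟩
    -- The largest left end point of the enlarged intervals is a common point: the condition for `i`
    -- and `j` keeps it below the right end point of `i`.
    · obtain ⟨j, hj⟩ := Finite.exists_max fun i => lo i - s i
      refine ⟨lo j - s j, fun i => ⟨hj i, ?_⟩⟩
      have h1 : setDist (Set.Icc (lo i) (hi i)) (Set.Icc (lo j) (hi j)) ≤ s i + s j := hP i j
      linarith [sub_le_setDist_Icc (h i) (h j)]
  · rintro ⟨τ, hτ⟩ i j
    obtain ⟨x, hx, hxτ⟩ := exists_mem_Icc_abs_sub_le (h i) (hs i) (hτ i).1 (hτ i).2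
    obtain ⟨y, hy, hyτ⟩ := exists_mem_Icc_abs_sub_le (h j) (hs j) (hτ j).1 (hτ j).2
    refine (setDist_Icc_le hx hy).trans ((abs_sub_le x τ y).trans ?_)
    rw [abs_sub_comm τ y]
    exact add_le_add hxτ hyτ

theorem theorem2p6 {S : Type*} [TopologicalSpace S] [T2Space S] [CompactSpace S]
    [ConnectedSpace S] [ChartedSpace (EuclideanSpace ℝ (Fin 2)) S]
    {V : Type*} [Fintype V] {G : SimpleGraph V} {Φ : Type*} [Fintype Φ]
    (K : CellularSubdivision S G Φ) (hK : K.IsOrientable)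
    (r : V → V → ℝ) (hr : ∀ x y, 0 ≤ r x y) (hrG : ∀ x y, ¬ G.Adj x y → r x y = 0)
    (hφ : weightField G r ∈ K.boundaries) :
    ∀ (o : Φ → Bool) (ho : K.IsCoherent o) (E' : Set G.Dart), IsEdgeOrientation E' →
      ∀ ψ ∈ twoChains Φ, K.boundary ψ = weightField G r →
        (r ∈ K.elementaryWeights ↔
          (fun d : E' => symmetricPart r d.1.fst d.1.snd) ∈
            intervalPolyhedron (fun d : E' => K.interval ho ψ d.1)) := by
  classical
  intro o ho E' hE' ψ hψ hdψ
  have : Finite G.Dart := Finite.of_injective _ SimpleGraph.Dart.toProd_injective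
  have hψd : ∀ d : G.Dart,
      r d.fst d.snd - r d.snd d.fst = ψ (K.cellOf ho d) - ψ (K.cellOf ho d.symm) := by
    intro d
    have h1 : K.boundary ψ d = r d.fst d.snd - r d.snd d.fst := congrFun hdψ d
    rw [← h1, K.boundary_eq ho, hψ (K.cellOf ho d.symm)]
    ring
  have hrank : 1 < Module.rank ℝ (EuclideanSpace ℝ (Fin 2)) := by
    rw [← Module.finrank_eq_rank, finrank_euclideanSpace_fin]
    norm_num
  -- The bounds on `τ` do not change when an edge is reversed, so they may be imposed on all
  -- oriented edges instead of on `E'`.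
  have hpoly : (fun d : E' => symmetricPart r d.1.fst d.1.snd) ∈
      intervalPolyhedron (fun d : E' => K.interval ho ψ d.1) ↔
      ∃ τ, ∀ d : G.Dart,
        min (ψ (K.cellOf ho d.symm)) (ψ (K.cellOf ho d)) - symmetricPart r d.fst d.snd ≤ τ ∧
        τ ≤ max (ψ (K.cellOf ho d.symm)) (ψ (K.cellOf ho d)) + symmetricPart r d.fst d.snd := by
    refine (mem_intervalPolyhedron_Icc_iff (fun _ => min_le_max)
      fun d => symmetricPart_nonneg hr _ _).trans
      (exists_congr fun τ => ⟨fun h d => ?_, fun h d => h d.1⟩)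
    by_cases hd : d ∈ E'
    · exact h ⟨d, hd⟩
    · have h1 := h ⟨d.symm, (hE' d).2 hd⟩
      rw [SimpleGraph.Dart.symm_symm, min_comm, max_comm] at h1
      rwa [symmetricPart_comm r d.fst d.snd]
  rw [hpoly, K.mem_elementaryWeights_iff]
  constructor
  · rintro ⟨-, β, hβ, hβs, a, ha, hra⟩
    simp only [K.boundary_eq ho] at hra
    -- Subtracting the decompositions of `r` at `d` and `d.symm` cancels `β` and shows that this
    -- quantity agrees on both sides of the edge.
    have hτ : ∃ τ, ∀ c, ψ (c, o c) - (a (c, o c) - a (oppositeCell (c, o c))) = τ := by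
      rcases isEmpty_or_nonempty Φ with _ | ⟨⟨c₀⟩⟩
      · exact ⟨0, fun c => isEmptyElim c⟩
      · refine ⟨_, fun c => K.eq_of_forall_cellOf_eq hrank ho
          (t := fun c => ψ (c, o c) - (a (c, o c) - a (oppositeCell (c, o c)))) (fun d => ?_) c c₀⟩
        change ψ (K.cellOf ho d) - (a (K.cellOf ho d) - a (oppositeCell (K.cellOf ho d))) =
          ψ (K.cellOf ho d.symm) -
            (a (K.cellOf ho d.symm) - a (oppositeCell (K.cellOf ho d.symm)))
        have h1 := hra d
        have h2 : r d.snd d.fst = _ := hra d.symm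
        rw [SimpleGraph.Dart.symm_symm, hβs] at h2
        linarith [hψd d]
    obtain ⟨τ, hτ⟩ := hτ
    refine ⟨τ, fun d => ?_⟩
    have h1 := hra d
    have h2 : r d.snd d.fst = _ := hra d.symm
    rw [SimpleGraph.Dart.symm_symm, hβs] at h2
    have h3 : ψ (K.cellOf ho d) - (a (K.cellOf ho d) - a (oppositeCell (K.cellOf ho d))) = τ :=
      hτ _
    have h4 : ψ (K.cellOf ho d.symm) -
        (a (K.cellOf ho d.symm) - a (oppositeCell (K.cellOf ho d.symm))) = τ := hτ _
    have h5 := hβ d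
    have h6 := ha (K.cellOf ho d)
    have h7 := ha (K.cellOf ho d.symm)
    have h8 := ha (oppositeCell (K.cellOf ho d))
    have h9 := ha (oppositeCell (K.cellOf ho d.symm))
    rw [symmetricPart_eq_min]
    rcases le_total (ψ (K.cellOf ho d.symm)) (ψ (K.cellOf ho d)) with h | h
    · rw [min_eq_left h, max_eq_right h, min_eq_right (by linarith [hψd d])]
      constructor <;> linarith
    · rw [min_eq_right h, max_eq_left h, min_eq_left (by linarith [hψd d])]
      constructor <;> linarith
  · rintro ⟨τ, hτ⟩
    -- For `f` in `F'` the second branch at the opposite cell is the positive part of `τ - ψ f`,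
    -- since `ψ` is odd. This is the least nonnegative pair whose difference is `ψ f - τ`.
    let a : Φ × Bool → ℝ := fun f =>
      if f.2 = o f.1 then max (ψ f - τ) 0 else max (ψ f + τ) 0
    have ha₁ : ∀ d, a (K.cellOf ho d) = max (ψ (K.cellOf ho d) - τ) 0 := fun d =>
      if_pos (K.cellOf_snd ho d)
    have ha₂ : ∀ d, a (oppositeCell (K.cellOf ho d)) = max (τ - ψ (K.cellOf ho d)) 0 := by
      intro d
      have h1 : (oppositeCell (K.cellOf ho d)).2 ≠ o (oppositeCell (K.cellOf ho d)).1 :=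
        Bool.not_ne_self _
      have h2 : a (oppositeCell (K.cellOf ho d)) = max (ψ (oppositeCell (K.cellOf ho d)) + τ) 0 :=
        if_neg h1
      rw [h2, hψ (K.cellOf ho d), sub_neg_eq_add, add_comm]
    -- The symmetric term is forced to be the remainder. Its nonnegativity is the bound on `τ`; its
    -- symmetry holds because `a` and `ψ` give the same antisymmetric part.
    refine ⟨hrG, fun d => r d.fst d.snd - K.boundary a d, fun d => ?_, fun d => ?_, a,
      fun f => ?_, fun d => by ring⟩
    · have h1 := hτ d
      have h2 := hψd d
      have h3 := hr d.fst d.snd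
      have h4 := hr d.snd d.fst
      rw [symmetricPart_eq_min] at h1
      simp only [K.boundary_eq ho, ha₁, ha₂]
      rcases le_total (ψ (K.cellOf ho d.symm)) (ψ (K.cellOf ho d)) with h | h
      · rw [min_eq_left h, max_eq_right h, min_eq_right (by linarith)] at h1
        rcases max_cases (ψ (K.cellOf ho d) - τ) 0 with h5 | h5 <;>
        rcases max_cases (τ - ψ (K.cellOf ho d.symm)) 0 with h6 | h6 <;> linarith
      · rw [min_eq_right h, max_eq_left h, min_eq_left (by linarith)] at h1
        rcases max_cases (ψ (K.cellOf ho d) - τ) 0 with h5 | h5 <;>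
        rcases max_cases (τ - ψ (K.cellOf ho d.symm)) 0 with h6 | h6 <;> linarith
    · have h2 := hψd d
      have hmax : ∀ x : ℝ, max x 0 - max (-x) 0 = x := fun x => by
        rcases max_cases x 0 with h5 | h5 <;> rcases max_cases (-x) 0 with h6 | h6 <;> linarith
      have h3 := hmax (ψ (K.cellOf ho d) - τ)
      have h4 := hmax (ψ (K.cellOf ho d.symm) - τ)
      rw [neg_sub] at h3 h4
      simp only [K.boundary_eq ho, ha₁, ha₂, SimpleGraph.Dart.symm_symm]
      change r d.snd d.fst - _ = _
      linarith
    · dsimp only [a]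
      split_ifs <;> exact le_max_right _ _
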